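/- All graphs are finite and simple. A graph $G$ is a threshold graph if there are real vertex weights $w(v)$ and a real number $t$ such that distinct vertices $u,v$ are adjacent if and only if $w(u)+w(v)>t$. A search tree on a connected graph $G$ is a rooted tree with vertex set $V(G)$ whose root is some vertex $r$ and in which the children of $r$ are the roots of search trees on the connected components of $G-r$, one for each component. If $v$ is a child of $u$ in a search tree $T$, the $uv$-rotation makes $v$ take the place of $u$ (as a child of the former parent of $u$, or as the root if $u$ was the root), makes $u$ a child of $v$, moves each subtree of $v$ that contains a neighbour of $u$ in $G$ from $v$ to $u$, and leaves all other subtrees attached to their parents. The rotation graph $\mathcal{R}(G)$ has the search trees on $G$ as vertices, two of them being adjacent if and only if they differ by one rotation. (1) If $G$ is a connected threshold graph that is not complete, then $\chi(\mathcal{R}(G))=3$. (2) For $p\ge 1$ and $q\ge 2$ let $\mathrm{SPK}_{p,q}$ be the complete split graph, with vertex set the disjoint union of a clique $P$ of size $p$ and an independent set $Q$ of size $q$, and with all edges between $P$ and $Q$. It is a connected, non-complete threshold graph, and hence $\chi(\mathcal{R}(\mathrm{SPK}_{p,q}))=3$. Likewise every star $S$ with at least two leaves is a connected, non-complete threshold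 graph, and hence $\chi(\mathcal{R}(S))=3$; here $\mathcal{R}(S)$ is the $1$-skeleton of a stellohedron. (3) Every connected threshold graph can be obtained, up to isomorphism, from a single vertex by successively adding true twins of universal vertices (for a universal vertex $v$, a new vertex adjacent to $v$ and to all neighbours of $v$) and pendant vertices adjacent to universal vertices (for a universal vertex $v$, a new vertex adjacent to $v$ only). -/

import Mathlib

universe u

/-- A rooted tree with vertex set `V`, given by its root and its parent function: the root is the
only vertex without a parent, and every vertex is reached from the root by steps from a parent to
one of its children. -/
@[ext]
structure RootedTreeOn (V : Type u) where
  root : V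
  parent : V → Option V
  parent_eq_none_iff : ∀ v, parent v = none ↔ v = root
  reachable : ∀ v, Relation.ReflTransGen (fun a b => parent b = some a) root v

namespace RootedTreeOn

variable {V : Type u}

/-- `T.IsAncestor a b`: the vertex `a` lies on the path of `T` from the root to `b` (possibly
`a = b`); equivalently, `b` is a vertex of the subtree `T|a` of `T` rooted in `a`. -/
def IsAncestor (T : RootedTreeOn V) (a b : V) : Prop :=
  Relation.ReflTransGen (fun x y => T.parent y = some x) a b

end RootedTreeOn

namespace SimpleGraph

variable {V : Type u}

/-- `G.IsSearchTreeOn T S r`: the subtree of `T` rooted in `r` is a search tree on the subgraph of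
`G` induced by `S`. That is, `r` is a vertex of `S`, and the children of `r` in `T` are the roots
`child C` of search trees on the connected components `C` of `G[S] - r`, one for each component. -/
inductive IsSearchTreeOn (G : SimpleGraph V) (T : RootedTreeOn V) : Set V → V → Prop
  | node {S : Set V} {r : V} (root_mem : r ∈ S)
      (child : (G.induce (S \ {r})).ConnectedComponent → V)
      (children : ∀ v, T.parent v = some r ↔ ∃ C, child C = v)
      (subtrees : ∀ C, IsSearchTreeOn G T (Subtype.val '' C.supp) (child C)) :
      IsSearchTreeOn G T S r

/-- `T` is a search tree (elimination tree) on `G`. -/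
def IsSearchTree (G : SimpleGraph V) (T : RootedTreeOn V) : Prop :=
  G.IsSearchTreeOn T Set.univ T.root

/-- `T'` is obtained from `T` by the `uv`-rotation, where `v` is a child of `u` in `T`:
`v` takes the place of `u` below the former parent of `u` (`v` becomes the root if `u` was the
root), `u` becomes a child of `v`, a subtree of `v` which contains a neighbour of `u` in `G` is
moved to `u`, and all other subtrees stay at their parents. -/
structure IsRotation (G : SimpleGraph V) (T T' : RootedTreeOn V) (u v : V) : Prop where
  parent_v : T.parent v = some u
  parent'_u : T'.parent u = some v
  parent'_v : T'.parent v = T.parent u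
  parent'_move : ∀ w, T.parent w = some v → (∃ x, T.IsAncestor w x ∧ G.Adj u x) →
    T'.parent w = some u
  parent'_keep : ∀ w, T.parent w = some v → (¬ ∃ x, T.IsAncestor w x ∧ G.Adj u x) →
    T'.parent w = some v
  parent'_other : ∀ w, w ≠ u → w ≠ v → T.parent w ≠ some v → T'.parent w = T.parent w

/-- The rotation graph of `G`: its vertices are the search trees on `G`, and two search trees are
adjacent if they differ by one rotation. -/
def rotationGraph (G : SimpleGraph V) : SimpleGraph {T : RootedTreeOn V // G.IsSearchTree T} :=
  SimpleGraph.fromRel (fun T T' => ∃ u v, G.IsRotation T.1 T'.1 u v)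

/-- `G` is a threshold graph: there are real vertex weights and a real threshold such that two
distinct vertices are adjacent exactly when the sum of their weights exceeds the threshold. -/
def IsThreshold (G : SimpleGraph V) : Prop :=
  ∃ (w : V → ℝ) (t : ℝ), ∀ a b, a ≠ b → (G.Adj a b ↔ t < w a + w b)

/-- The graph obtained from `G` by adding a new vertex `none` with neighbourhood `K`. -/
def addVertex (G : SimpleGraph V) (K : Set V) : SimpleGraph (Option V) where
  Adj
    | none, none => False
    | none, some b => b ∈ K
    | some a, none => a ∈ K
    | some a, some b => G.Adj a b
  symm := ⟨by
    rintro (_ | a) (_ | b) h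
    · exact h
    · exact h
    · exact h
    · exact G.adj_symm h⟩
  loopless := ⟨by
    rintro (_ | a) h
    · exact h
    · exact G.irrefl h⟩

/-- Add a true twin of `v`: the new vertex is adjacent to `v` and to all neighbours of `v`. -/
def addTrueTwin (G : SimpleGraph V) (v : V) : SimpleGraph (Option V) :=
  G.addVertex (insert v (G.neighborSet v))

/-- Add a pendant vertex adjacent to `v`. -/
def addPendant (G : SimpleGraph V) (v : V) : SimpleGraph (Option V) :=
  G.addVertex {v}

/-- The graphs obtained, up to isomorphism, from a graph with a single vertex by successively adding
true twins of universal vertices and pendant vertices adjacent to universal vertices. -/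
inductive IsTwinPendantBuilt : ∀ {V : Type u}, SimpleGraph V → Prop
  | single {V : Type u} (G : SimpleGraph V) (h : Nat.card V = 1) : IsTwinPendantBuilt G
  | trueTwin {V : Type u} (G : SimpleGraph V) (v : V) (hv : G.IsUniversal v)
      (hG : IsTwinPendantBuilt G) : IsTwinPendantBuilt (G.addTrueTwin v)
  | pendant {V : Type u} (G : SimpleGraph V) (v : V) (hv : G.IsUniversal v)
      (hG : IsTwinPendantBuilt G) : IsTwinPendantBuilt (G.addPendant v)
  | iso {V W : Type u} (G : SimpleGraph V) (H : SimpleGraph W) (e : G ≃g H)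
      (hG : IsTwinPendantBuilt G) : IsTwinPendantBuilt H

/-- The complete split graph: the `p` vertices `Sum.inl i` form a clique, the `q` vertices
`Sum.inr j` form an independent set, and every `Sum.inl i` is adjacent to every `Sum.inr j`. -/
def completeSplitGraph (p q : ℕ) : SimpleGraph (Fin p ⊕ Fin q) :=
  SimpleGraph.fromRel (fun a b => a.isLeft ∨ b.isLeft)

end SimpleGraph

/-!
A connected threshold graph has a universal vertex `z` (a heaviest one), and its other vertices can
be listed so that each of them is adjacent to all vertices behind it in the list or to none of them
(`IsThreshold.exists_isThresholdList`). So, going through the list backwards, the graph grows from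
`z` by true twins of `z` and pendant vertices at `z`. The inductive form of this observation, in
which the next vertex to remove is a second universal vertex or else a lightest vertex other than
the universal one, is `IsThreshold.isTwinPendantBuilt`.

Upper bound. The vertices above a universal vertex `z` in a search tree form a path. For a pendant
vertex `x` at `z`, a search tree is a search tree of the graph without `x` together with the place
of `x`: a position on the path down to `z`, or below `z`. Each rotation changes only one of these
two data. Hence a proper colouring in `ZMod 3` of the search trees without `x` remains proper after
adding the position modulo `2` if `x` is above `z`, and `2` if `x` is below `z`. If `x` is a true
twin of `z`, then the upper one of `x` and `z` is removed instead, and the lower one plays the role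
of `z`. Its position and the bit telling which of the two is the upper one together run through a
path, so adding their sum modulo `2` works. Unfolding this recursion gives `searchColor`, which only
depends on the ancestor relation of the search tree. The effect of a rotation on that relation is
recorded in `AncestorSwap`, whose symmetric axioms use only that adjacent vertices are comparable in
a search tree and that a vertex has a neighbour below each of its children. That exactly one summand
changes is `AncestorSwap.searchColor_ne`, by simultaneous use of `AncestorSwap.searchColor_eq` (the
swapped vertices are not both present) and `AncestorSwap.searchColor_eq_of_twins` (they are merged).

Lower bound. A connected threshold graph that is not complete has a universal vertex `b` and two
nonadjacent vertices `a`, `d`. Below a path through all other vertices, the five search trees on the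
path `a`, `b`, `d` form a cycle of length five (`not_colorable_two_rotationGraph`).
-/

/-! ### Ancestors in rooted trees -/

namespace RootedTreeOn

variable {V : Type u} {T : RootedTreeOn V} {a b c p : V}

lemma isAncestor_iff : T.IsAncestor a b ↔ a = b ∨ ∃ p, T.parent b = some p ∧ T.IsAncestor a p := by
  unfold IsAncestor
  rw [Relation.ReflTransGen.cases_tail_iff, eq_comm]
  simp only [and_comm]

lemma isAncestor_iff_of_parent (h : T.parent b = some p) :
    T.IsAncestor a b ↔ a = b ∨ T.IsAncestor a p := by
  rw [isAncestor_iff]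
  simp [h]

lemma isAncestor_refl (a : V) : T.IsAncestor a a := Relation.ReflTransGen.refl

lemma IsAncestor.trans (h : T.IsAncestor a b) (h' : T.IsAncestor b c) : T.IsAncestor a c :=
  Relation.ReflTransGen.trans h h'

lemma isAncestor_of_parent (h : T.parent b = some a) : T.IsAncestor a b :=
  Relation.ReflTransGen.single h

lemma parent_root : T.parent T.root = none := (T.parent_eq_none_iff _).2 rfl

lemma not_transGen_self (x : V) : ¬ Relation.TransGen (fun a b => T.parent b = some a) x x := by
  induction T.reachable x with
  | refl =>
    intro h
    obtain ⟨c, -, hc⟩ := Relation.TransGen.tail'_iff.1 h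
    simp [parent_root] at hc
  | @tail p y _ hpy ih =>
    intro h
    obtain ⟨c, hyc, hc⟩ := Relation.TransGen.tail'_iff.1 h
    obtain rfl : p = c := by simpa [hpy] using hc
    exact ih (Relation.TransGen.head' hpy hyc)

lemma IsAncestor.antisymm (h : T.IsAncestor a b) (h' : T.IsAncestor b a) : a = b := by
  rcases Relation.reflTransGen_iff_eq_or_transGen.1 h with e | h
  · exact e.symm
  · exact (not_transGen_self _ (h.trans_left h')).elim

lemma IsAncestor.total (h : T.IsAncestor a c) (h' : T.IsAncestor b c) :
    T.IsAncestor a b ∨ T.IsAncestor b a := by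
  induction h with
  | refl => exact .inr h'
  | @tail p y h₁ hpy ih =>
    rcases (isAncestor_iff_of_parent hpy).1 h' with rfl | h''
    · exact .inl (h₁.tail hpy)
    · exact ih h''

lemma ne_of_parent (h : T.parent b = some a) : a ≠ b := by
  rintro rfl
  exact not_transGen_self _ (.single h)

end RootedTreeOn

namespace SimpleGraph

variable {V : Type u} {G : SimpleGraph V} {T T' : RootedTreeOn V}

/-! ### Search trees -/

lemma IsSearchTreeOn.isAncestor_iff {S : Set V} {r : V} (h : G.IsSearchTreeOn T S r) (x : V) :
    T.IsAncestor r x ↔ x ∈ S := by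
  induction h with
  | @node S r hr child hc hs ih =>
    constructor
    · intro h
      rcases Relation.ReflTransGen.cases_head h with rfl | ⟨c, hrc, hcx⟩
      · exact hr
      · obtain ⟨C, rfl⟩ := (hc c).1 hrc
        obtain ⟨y, -, rfl⟩ := (ih C).1 hcx
        exact y.2.1
    · intro hx
      by_cases hxr : x = r
      · exact hxr ▸ T.isAncestor_refl _
      · let y : ↥(S \ {r}) := ⟨x, hx, hxr⟩
        refine .head ((hc _).2 ⟨(G.induce (S \ {r})).connectedComponentMk y, rfl⟩) ?_
        exact (ih _).2 ⟨y, rfl, rfl⟩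

/-- The endpoints of an edge lie in the same component until one of them is removed. -/
lemma IsSearchTreeOn.isAncestor_or_of_adj {S : Set V} {r : V} (h : G.IsSearchTreeOn T S r)
    {x y : V} (hx : x ∈ S) (hy : y ∈ S) (hxy : G.Adj x y) :
    T.IsAncestor x y ∨ T.IsAncestor y x := by
  have hS := h
  induction h with
  | @node S r hr child hc hs ih =>
    by_cases hxr : x = r
    · exact .inl (hxr ▸ (hS.isAncestor_iff _).2 hy)
    by_cases hyr : y = r
    · exact .inr (hyr ▸ (hS.isAncestor_iff _).2 hx)
    let x' : ↥(S \ {r}) := ⟨x, hx, hxr⟩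
    let y' : ↥(S \ {r}) := ⟨y, hy, hyr⟩
    have hadj : (G.induce (S \ {r})).Adj y' x' := hxy.symm
    exact ih ((G.induce (S \ {r})).connectedComponentMk x') ⟨x', rfl, rfl⟩
      ⟨y', ConnectedComponent.connectedComponentMk_eq_of_adj hadj, rfl⟩ (hs _)

lemma Preconnected.exists_adj_of_mem_of_notMem {W : Type*} {H : SimpleGraph W}
    (hH : H.Preconnected) {A : Set W} {a b : W} (ha : a ∈ A) (hb : b ∉ A) :
    ∃ x ∈ A, ∃ y ∉ A, H.Adj x y := by
  obtain ⟨p⟩ := hH a b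
  obtain ⟨d, -, h₁, h₂⟩ := p.exists_boundary_dart A ha hb
  exact ⟨_, h₁, _, h₂, d.adj⟩

/-- In a search tree on a connected graph, every vertex `a` has a neighbour below each of its
children: the vertices below a child form a component of a connected graph with `a` removed. -/
lemma IsSearchTreeOn.exists_adj_of_parent {S : Set V} {r : V} (h : G.IsSearchTreeOn T S r)
    (hG : (G.induce S).Preconnected) {a b : V} (ha : a ∈ S) (hab : T.parent b = some a) :
    ∃ w, T.IsAncestor b w ∧ G.Adj a w := by
  induction h with
  | @node S r hr child hc hs ih =>
    by_cases har : a = r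
    · subst har
      obtain ⟨C, rfl⟩ := (hc b).1 hab
      obtain ⟨c, hcC⟩ := C.nonempty_supp
      obtain ⟨x, hx, y, hy, hxy⟩ := hG.exists_adj_of_mem_of_notMem
        (A := {x | x.1 ∈ Subtype.val '' C.supp}) (a := ⟨c, c.2.1⟩) (b := ⟨a, hr⟩)
        ⟨c, hcC, rfl⟩ (by rintro ⟨z, -, hz⟩; exact z.2.2 hz)
      obtain ⟨x', hx', hxx'⟩ := hx
      have hya : y.1 = a := by
        by_contra hya
        refine hy ⟨⟨y, y.2, hya⟩, C.mem_supp_of_adj_mem_supp hx' ?_, rfl⟩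
        change G.Adj x'.1 y.1
        rw [hxx']
        exact hxy
      refine ⟨x, ((hs C).isAncestor_iff _).2 ⟨x', hx', hxx'⟩, ?_⟩
      have : G.Adj x.1 y.1 := hxy
      rw [hya] at this
      exact this.symm
    · let a' : ↥(S \ {r}) := ⟨a, ha, har⟩
      set C := (G.induce (S \ {r})).connectedComponentMk a' with hC
      refine ih C ?_ ⟨a', rfl, rfl⟩
      have hcon := C.connected_toSimpleGraph.preconnected
      refine hcon.map (H := G.induce (Subtype.val '' C.supp)) ⟨fun x => ⟨x.1.1, x.1, x.2, rfl⟩, ?_⟩ ?_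
      · exact fun h => h
      · rintro ⟨_, x, hx, rfl⟩
        exact ⟨⟨x, hx⟩, rfl⟩

/-- The properties of the ancestor relation `R` of a search tree used for colouring: it is a forest
order in which adjacent vertices are comparable. -/
structure IsSearchOrder (G : SimpleGraph V) (R : V → V → Prop) : Prop where
  refl : ∀ x, R x x
  trans : ∀ {x y z}, R x y → R y z → R x z
  antisymm : ∀ {x y}, R x y → R y x → x = y
  chain : ∀ {x y z}, R x z → R y z → R x y ∨ R y x
  total_of_adj : ∀ {x y}, G.Adj x y → R x y ∨ R y x

lemma IsSearchTree.isSearchOrder (h : G.IsSearchTree T) : G.IsSearchOrder T.IsAncestor where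
  refl := T.isAncestor_refl
  trans := .trans
  antisymm := RootedTreeOn.IsAncestor.antisymm
  chain := RootedTreeOn.IsAncestor.total
  total_of_adj := IsSearchTreeOn.isAncestor_or_of_adj h trivial trivial

lemma IsSearchTree.exists_adj_of_parent (h : G.IsSearchTree T) (hG : G.Connected) {a b : V}
    (hab : T.parent b = some a) : ∃ w, T.IsAncestor b w ∧ G.Adj a w :=
  IsSearchTreeOn.exists_adj_of_parent h
    ((Iso.preconnected_iff (induceUnivIso G)).2 hG.preconnected) trivial hab

/-! ### Rotations and the ancestor order -/

/-- A rotation at `a`, `b` only affects the descendants of `a` and of `b`. -/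
lemma IsRotation.isAncestor_iff {a b : V} (h : G.IsRotation T T' a b) {x : V} (hxa : x ≠ a)
    (hxb : x ≠ b) (y : V) : T.IsAncestor x y ↔ T'.IsAncestor x y := by
  have key : T'.IsAncestor x a ↔ T'.IsAncestor x b := by
    rw [RootedTreeOn.isAncestor_iff_of_parent h.parent'_u, or_iff_right hxa]
  induction T.reachable y with
  | refl =>
    by_cases ha : T.root = a
    · rw [RootedTreeOn.isAncestor_iff, RootedTreeOn.parent_root, ha, key,
        RootedTreeOn.isAncestor_iff (T := T'), h.parent'_v, ← ha, RootedTreeOn.parent_root]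
      simp [hxb, ha ▸ hxa]
    · have hb : T.root ≠ b := by
        intro hb
        have := h.parent_v
        rw [← hb, RootedTreeOn.parent_root] at this
        simp at this
      rw [RootedTreeOn.isAncestor_iff, RootedTreeOn.isAncestor_iff (T := T'),
        h.parent'_other _ ha hb (by simp [RootedTreeOn.parent_root]), RootedTreeOn.parent_root]
      simp
  | @tail p y _ hpy ih =>
    change T.parent y = some p at hpy
    replace ih : T.IsAncestor x p ↔ T'.IsAncestor x p := ih
    by_cases hya : y = a
    · subst hya
      rw [key, RootedTreeOn.isAncestor_iff_of_parent (h.parent'_v.trans hpy),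
        RootedTreeOn.isAncestor_iff_of_parent hpy, ih]
      simp [hxa, hxb]
    by_cases hyb : y = b
    · subst hyb
      obtain rfl : a = p := by simpa [h.parent_v] using hpy
      rw [← key, RootedTreeOn.isAncestor_iff_of_parent hpy, ih]
      simp [hxb]
    rw [RootedTreeOn.isAncestor_iff_of_parent hpy, ih]
    by_cases hpb : p = b
    · subst hpb
      by_cases hm : ∃ x, T.IsAncestor y x ∧ G.Adj a x
      · rw [RootedTreeOn.isAncestor_iff_of_parent (h.parent'_move y hpy hm), key]
      · rw [RootedTreeOn.isAncestor_iff_of_parent (h.parent'_keep y hpy hm)]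
    · have := h.parent'_other y hya hyb (by simpa [hpy] using hpb)
      rw [RootedTreeOn.isAncestor_iff_of_parent (this.trans hpy)]

lemma IsRotation.ne {a b : V} (h : G.IsRotation T T' a b) : T ≠ T' := by
  rintro rfl
  exact RootedTreeOn.ne_of_parent h.parent_v ((RootedTreeOn.isAncestor_of_parent h.parent_v).antisymm
    (RootedTreeOn.isAncestor_of_parent h.parent'_u))

/-- The effect of a rotation at `a`, `b` on ancestor relations, in a form that is symmetric under
exchanging the two relations together with `a` and `b`. -/
structure AncestorSwap (G : SimpleGraph V) (R R' : V → V → Prop) (a b : V) : Prop where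
  left : G.IsSearchOrder R
  right : G.IsSearchOrder R'
  ne : a ≠ b
  iff_of_ne : ∀ {x}, x ≠ a → x ≠ b → ∀ y, R x y ↔ R' x y
  rel : R a b
  rel' : R' b a
  rel_of_rel : ∀ {x}, x ≠ b → R x b → R x a
  rel'_of_rel' : ∀ {x}, x ≠ a → R' x a → R' x b
  exists_adj : ∃ w, R b w ∧ G.Adj a w
  exists_adj' : ∃ w, R' a w ∧ G.Adj b w

lemma IsRotation.ancestorSwap {a b : V} (h : G.IsRotation T T' a b) (hG : G.Connected)
    (hT : G.IsSearchTree T) (hT' : G.IsSearchTree T') :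
    G.AncestorSwap T.IsAncestor T'.IsAncestor a b where
  left := hT.isSearchOrder
  right := hT'.isSearchOrder
  ne := RootedTreeOn.ne_of_parent h.parent_v
  iff_of_ne := h.isAncestor_iff
  rel := RootedTreeOn.isAncestor_of_parent h.parent_v
  rel' := RootedTreeOn.isAncestor_of_parent h.parent'_u
  rel_of_rel hx := by simp [RootedTreeOn.isAncestor_iff_of_parent h.parent_v, hx]
  rel'_of_rel' hx := by simp [RootedTreeOn.isAncestor_iff_of_parent h.parent'_u, hx]
  exists_adj := hT.exists_adj_of_parent hG h.parent_v
  exists_adj' := hT'.exists_adj_of_parent hG h.parent'_u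

namespace AncestorSwap

variable {R R' : V → V → Prop} {a b x y z : V}

lemma symm (h : G.AncestorSwap R R' a b) : G.AncestorSwap R' R b a where
  left := h.right
  right := h.left
  ne := h.ne.symm
  iff_of_ne h₁ h₂ y := (h.iff_of_ne h₂ h₁ y).symm
  rel := h.rel'
  rel' := h.rel
  rel_of_rel := h.rel'_of_rel'
  rel'_of_rel' := h.rel_of_rel
  exists_adj := h.exists_adj'
  exists_adj' := h.exists_adj

lemma iff_of_adj (h : G.AncestorSwap R R' a b) (hxy : G.Adj x y) (hne : s(x, y) ≠ s(a, b)) :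
    R x y ↔ R' x y := by
  have aux : ∀ {R : V → V → Prop}, G.IsSearchOrder R → (R x y ↔ ¬ R y x) := fun hR =>
    ⟨fun h₁ h₂ => hxy.ne (hR.antisymm h₁ h₂), (hR.total_of_adj hxy).resolve_right⟩
  by_cases hx : x ≠ a ∧ x ≠ b
  · exact h.iff_of_ne hx.1 hx.2 y
  · have hy : y ≠ a ∧ y ≠ b := by
      have := hxy.ne
      have := h.ne
      simp only [ne_eq, Sym2.eq_iff] at hne
      grind
    rw [aux h.left, aux h.right, h.iff_of_ne hy.1 hy.2]

/-- Two vertices above a common neighbour are compared alike before and after the swap, even though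
they need not be adjacent. -/
lemma rel_of_rel_of_adj (h : G.AncestorSwap R R' a b) (hxz : G.Adj x z) (hyz : G.Adj y z)
    (hxy : s(x, y) ≠ s(a, b)) (hne : s(x, z) ≠ s(a, b)) (hx : R x z) (hyx : R y x) : R' y x := by
  by_cases hy : y ≠ a ∧ y ≠ b
  · exact (h.iff_of_ne hy.1 hy.2 x).1 hyx
  by_cases hyx' : y = x
  · exact hyx' ▸ h.right.refl _
  have hxab : x ≠ a ∧ x ≠ b := by
    simp only [ne_eq, Sym2.eq_iff] at hxy
    grind
  have hx' : R' x z := (h.iff_of_adj hxz hne).1 hx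
  by_cases hyzab : s(y, z) = s(a, b)
  · -- The vertex `x` would lie strictly between `a` and `b`.
    rcases Sym2.eq_iff.1 hyzab with ⟨rfl, rfl⟩ | ⟨rfl, rfl⟩
    · exact (hyx' (h.left.antisymm hyx (h.rel_of_rel hxab.2 hx))).elim
    · exact (hyx' (h.left.antisymm hyx (h.left.trans hx h.rel))).elim
  · have hy' : R' y z := (h.iff_of_adj hyz hyzab).1 (h.left.trans hyx hx)
    refine (h.right.chain hy' hx').resolve_right fun hxy' => hyx' ?_
    exact h.left.antisymm hyx ((h.iff_of_ne hxab.1 hxab.2 y).2 hxy')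

lemma iff_of_rel_of_adj (h : G.AncestorSwap R R' a b) (hxz : G.Adj x z) (hyz : G.Adj y z)
    (hxy : s(x, y) ≠ s(a, b)) (hne : s(x, z) ≠ s(a, b)) (hx : R x z) : R y x ↔ R' y x :=
  ⟨h.rel_of_rel_of_adj hxz hyz hxy hne hx,
    h.symm.rel_of_rel_of_adj hxz hyz (by rwa [Sym2.eq_swap (a := b)])
      (by rwa [Sym2.eq_swap (a := b)]) ((h.iff_of_adj hxz hne).1 hx)⟩

end AncestorSwap

end SimpleGraph

/-! ### The colouring of search trees -/

section

variable {α : Type*}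

lemma List.even_countP_iff_of_agree_off [DecidableEq α] {p q : α → Prop} [DecidablePred p]
    [DecidablePred q] {L : List α} (hL : L.Nodup) {y : α} (hy : y ∈ L)
    (h : ∀ w ∈ L, w ≠ y → (p w ↔ q w)) (hpq : p y ↔ ¬ q y) :
    Even (L.countP p) ↔ ¬ Even (L.countP q) := by
  have hrest : (L.erase y).countP p = (L.erase y).countP q := by
    refine List.countP_congr fun w hw => ?_
    obtain ⟨hwy, hw⟩ := hL.mem_erase_iff.1 hw
    simpa using h w hw hwy
  have hperm := List.perm_cons_erase hy
  rw [hperm.countP_eq, hperm.countP_eq (q : α → Prop), List.countP_cons, List.countP_cons, hrest]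
  by_cases hq : q y <;> simp [hpq, hq, Nat.even_add_one]

end

namespace SimpleGraph

variable {V : Type u} {G : SimpleGraph V}

/-- A list of vertices such that every entry is adjacent to all entries behind it or to none. -/
def IsThresholdList (G : SimpleGraph V) : List V → Prop
  | [] => True
  | x :: L => ((∀ y ∈ L, G.Adj x y) ∨ ∀ y ∈ L, ¬ G.Adj x y) ∧ G.IsThresholdList L

/-- The residue of `n` modulo `2`, as one of the colours `0` and `1`. -/
def parityColor (n : ℕ) : ZMod 3 := if Even n then 0 else 1

lemma parityColor_eq_iff {m n : ℕ} : parityColor m = parityColor n ↔ (Even m ↔ Even n) := by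
  unfold parityColor
  split_ifs with h₁ h₂ h₂ <;> simp [h₁, h₂]

lemma parityColor_ne_two (n : ℕ) : parityColor n ≠ 2 := by
  unfold parityColor
  split_ifs <;> decide

open Classical in
/-- The colour of a search order `R` on a vertex `z` together with the vertices of a list `L` all
of which are adjacent to `z`. If the first entry `x` of the list is adjacent to the remaining ones,
it is a true twin of `z`: the upper one of `x` and `z` is removed, the lower one takes the role of
`z`, and the summand is the parity of the number of remaining entries above the removed vertex, plus one
if that vertex is `z`. Otherwise `x` is a pendant vertex at `z`; its summand is the third colour if it
is below `z`, and the parity of the number of remaining entries above it if it is above `z`. An entry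
with nothing behind it counts as a twin. -/
noncomputable def searchColor (G : SimpleGraph V) (R : V → V → Prop) : V → List V → ZMod 3
  | _, [] => 0
  | z, x :: L =>
    if ∀ y ∈ L, G.Adj x y then
      if R z x then G.searchColor R x L + parityColor (L.countP (R · z) + 1)
      else G.searchColor R z L + parityColor (L.countP (R · x))
    else G.searchColor R z L + if R z x then 2 else parityColor (L.countP (R · x))

section

variable {R : V → V → Prop} {x z : V} {L : List V}

open Classical in
lemma searchColor_of_twin_below (hx : ∀ y ∈ L, G.Adj x y) (h : R z x) :
    G.searchColor R z (x :: L) = G.searchColor R x L + parityColor (L.countP (R · z) + 1) := by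
  rw [searchColor, if_pos hx, if_pos h]

open Classical in
lemma searchColor_of_twin_above (hx : ∀ y ∈ L, G.Adj x y) (h : ¬ R z x) :
    G.searchColor R z (x :: L) = G.searchColor R z L + parityColor (L.countP (R · x)) := by
  rw [searchColor, if_pos hx, if_neg h]

lemma searchColor_of_pendant_below (hx : ¬ ∀ y ∈ L, G.Adj x y) (h : R z x) :
    G.searchColor R z (x :: L) = G.searchColor R z L + 2 := by
  rw [searchColor, if_neg hx, if_pos h]

open Classical in
lemma searchColor_of_pendant_above (hx : ¬ ∀ y ∈ L, G.Adj x y) (h : ¬ R z x) :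
    G.searchColor R z (x :: L) = G.searchColor R z L + parityColor (L.countP (R · x)) := by
  rw [searchColor, if_neg hx, if_neg h]

end

namespace AncestorSwap

variable {R R' : V → V → Prop} {a b z : V} {L : List V}

open Classical in
lemma countP_eq_of_adj (h : G.AncestorSwap R R' a b) (hz : ∀ y ∈ L, G.Adj z y)
    (hne : ∀ y ∈ L, s(y, z) ≠ s(a, b)) : L.countP (R · z) = L.countP (R' · z) :=
  List.countP_congr fun y hy => by simpa using h.iff_of_adj (hz y hy).symm (hne y hy)

open Classical in
lemma countP_eq_of_rel {x : V} (h : G.AncestorSwap R R' a b) (hz : ∀ y ∈ L, G.Adj z y)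
    (hx : G.Adj x z) (hxz : R x z) (hxzab : s(x, z) ≠ s(a, b)) (hne : ∀ y ∈ L, s(x, y) ≠ s(a, b)) :
    L.countP (R · x) = L.countP (R' · x) :=
  List.countP_congr fun y hy => by
    simpa using h.iff_of_rel_of_adj hx (hz y hy).symm (hne y hy) hxzab hxz

/-- A swap of two vertices not both among `z :: L` does not change the colour. -/
lemma searchColor_eq (h : G.AncestorSwap R R' a b) (hz : ∀ y ∈ L, G.Adj z y)
    (hL : G.IsThresholdList L) (hne : ¬ (a ∈ z :: L ∧ b ∈ z :: L)) :
    G.searchColor R z L = G.searchColor R' z L := by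
  induction L generalizing z with
  | nil => rfl
  | cons x L ih =>
    have hzx : G.Adj z x := hz x (by simp)
    have hzL : ∀ y ∈ L, G.Adj z y := fun y hy => hz y (by simp [hy])
    have hp : s(x, z) ≠ s(a, b) := by rw [ne_eq, Sym2.eq_iff]; grind
    have hR : R z x ↔ R' z x := h.iff_of_adj hzx (by rwa [Sym2.eq_swap])
    have hxz : ¬ R z x → R x z := (h.left.total_of_adj hzx).resolve_left
    have hnx : ¬ (a ∈ x :: L ∧ b ∈ x :: L) := by grind
    have hnz : ¬ (a ∈ z :: L ∧ b ∈ z :: L) := by grind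
    by_cases hx : ∀ y ∈ L, G.Adj x y <;> by_cases hzx' : R z x
    · rw [searchColor_of_twin_below hx hzx', searchColor_of_twin_below hx (hR.1 hzx'),
        ih hx hL.2 hnx, h.countP_eq_of_adj hzL (by simp only [ne_eq, Sym2.eq_iff]; grind)]
    · rw [searchColor_of_twin_above hx hzx', searchColor_of_twin_above hx (mt hR.2 hzx'),
        ih hzL hL.2 hnz, h.countP_eq_of_rel hzL hzx.symm (hxz hzx') hp
          (by simp only [ne_eq, Sym2.eq_iff]; grind)]
    · rw [searchColor_of_pendant_below hx hzx', searchColor_of_pendant_below hx (hR.1 hzx'),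
        ih hzL hL.2 hnz]
    · rw [searchColor_of_pendant_above hx hzx', searchColor_of_pendant_above hx (mt hR.2 hzx'),
        ih hzL hL.2 hnz, h.countP_eq_of_rel hzL hzx.symm (hxz hzx') hp
          (by simp only [ne_eq, Sym2.eq_iff]; grind)]

lemma rel_iff_of_adj_adj (h : G.AncestorSwap R R' a b) {x : V} (hxa : x ≠ a) (hxb : x ≠ b)
    (hax : G.Adj a x) (hbx : G.Adj b x) : R b x ↔ R' a x := by
  have h₁ := h.iff_of_adj hax (by rw [ne_eq, Sym2.eq_iff]; grind)
  have h₂ := h.iff_of_adj hbx (by rw [ne_eq, Sym2.eq_iff]; grind)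
  exact ⟨fun hb => h₁.1 (h.left.trans h.rel hb), fun ha => h₂.2 (h.right.trans h.rel' ha)⟩

lemma rel_iff_rel (h : G.AncestorSwap R R' a b) {x : V} (hxa : x ≠ a) (hxb : x ≠ b) :
    R x b ↔ R' x a :=
  ⟨fun hb => (h.iff_of_ne hxa hxb a).1 (h.rel_of_rel hxb hb),
    fun ha => (h.iff_of_ne hxa hxb b).2 (h.rel'_of_rel' hxa ha)⟩

open Classical in
/-- If the lower one of the swapped vertices takes the role of `z` both before and after the swap, and
the upper one is absent, then the colour does not change. -/
lemma searchColor_eq_of_twins (h : G.AncestorSwap R R' a b) (ha : ∀ y ∈ L, G.Adj a y)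
    (hb : ∀ y ∈ L, G.Adj b y) (haL : a ∉ L) (hbL : b ∉ L) (hL : G.IsThresholdList L) :
    G.searchColor R b L = G.searchColor R' a L := by
  induction L with
  | nil => rfl
  | cons x L ih =>
    have hax : G.Adj a x := ha x (by simp)
    have hbx : G.Adj b x := hb x (by simp)
    have haL' : ∀ y ∈ L, G.Adj a y := fun y hy => ha y (by simp [hy])
    have hbL' : ∀ y ∈ L, G.Adj b y := fun y hy => hb y (by simp [hy])
    obtain ⟨hxa, haL⟩ : a ≠ x ∧ a ∉ L := by simpa using haL
    obtain ⟨hxb, hbL⟩ : b ≠ x ∧ b ∉ L := by simpa using hbL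
    have hR : R b x ↔ R' a x := h.rel_iff_of_adj_adj (Ne.symm hxa) (Ne.symm hxb) hax hbx
    have hnx : ¬ (a ∈ x :: L ∧ b ∈ x :: L) := by grind
    have hc : ¬ R b x → L.countP (fun y => R y x) = L.countP (fun y => R' y x) := fun hbx' =>
      h.countP_eq_of_rel hbL' hbx.symm ((h.left.total_of_adj hbx).resolve_left hbx')
        (by rw [ne_eq, Sym2.eq_iff]; grind) (by simp only [ne_eq, Sym2.eq_iff]; grind)
    by_cases hx : ∀ y ∈ L, G.Adj x y <;> by_cases hzx' : R b x
    · have : L.countP (fun y => R y b) = L.countP (fun y => R' y a) := by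
        refine List.countP_congr fun y hy => ?_
        simpa using h.rel_iff_rel (by grind) (by grind)
      rw [searchColor_of_twin_below hx hzx', searchColor_of_twin_below hx (hR.1 hzx'),
        h.searchColor_eq hx hL.2 hnx, this]
    · rw [searchColor_of_twin_above hx hzx', searchColor_of_twin_above hx (mt hR.2 hzx'),
        ih haL' hbL' haL hbL hL.2, hc hzx']
    · rw [searchColor_of_pendant_below hx hzx', searchColor_of_pendant_below hx (hR.1 hzx'),
        ih haL' hbL' haL hbL hL.2]
    · rw [searchColor_of_pendant_above hx hzx', searchColor_of_pendant_above hx (mt hR.2 hzx'),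
        ih haL' hbL' haL hbL hL.2, hc hzx']

open Classical in
/-- If `x` is swapped with an entry of the list `L`, then the number of entries of `L` above `x`
changes by one. -/
lemma parityColor_ne {x y : V} (h : G.AncestorSwap R R' a b) (hL : L.Nodup) (hxL : x ∉ L)
    (hy : y ∈ L) (hab : s(x, y) = s(a, b)) (k : ℕ) :
    parityColor (L.countP (R · x) + k) ≠ parityColor (L.countP (R' · x) + k) := by
  have hx : x = a ∧ y = b ∨ x = b ∧ y = a := Sym2.eq_iff.1 hab
  have hxy : x ≠ y := by grind
  have hyx : R y x ↔ ¬ R' y x := by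
    rcases hx with ⟨rfl, rfl⟩ | ⟨rfl, rfl⟩
    · exact iff_of_false (fun hr => hxy (h.left.antisymm h.rel hr)) (not_not.2 h.rel')
    · exact iff_of_true h.rel (fun hr => hxy (h.right.antisymm h.rel' hr))
  have := List.even_countP_iff_of_agree_off (p := (R · x)) (q := (R' · x)) hL hy
    (fun w hw hwy => by
      refine h.iff_of_ne ?_ ?_ x <;> grind) hyx
  rw [ne_eq, parityColor_eq_iff, Nat.even_add, Nat.even_add]
  grind

/-- A vertex `x` whose neighbours all are above it is not swapped with a vertex not adjacent to it:
nothing below `x` could connect the two. -/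
lemma ne_of_forall_adj_rel (h : G.AncestorSwap R R' a b) {x y : V}
    (hx : ∀ w, G.Adj x w → R w x) (hxy : ¬ G.Adj x y) : s(x, y) ≠ s(a, b) := by
  intro hab
  rcases Sym2.eq_iff.1 hab with ⟨rfl, rfl⟩ | ⟨rfl, rfl⟩
  · obtain ⟨w, hw, hxw⟩ := h.exists_adj
    exact hxw.ne (h.left.antisymm (h.left.trans h.rel hw) (hx w hxw))
  · obtain ⟨w, hw, hxw⟩ := h.exists_adj'
    have hwy : w ≠ y := by rintro rfl; exact hxy hxw
    have := (h.iff_of_ne hwy hxw.ne' y).1 (h.rel_of_rel hxw.ne' (hx w hxw))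
    exact hwy (h.right.antisymm this hw)

/-- A swap of two vertices among `z :: L` changes the colour. The last hypothesis holds throughout
the recursion defining the colour: a removed vertex either was above `z`, or was a pendant vertex
not adjacent to the remaining list. -/
lemma searchColor_ne (h : G.AncestorSwap R R' a b) (hz : ∀ y ∈ L, G.Adj z y)
    (hL : G.IsThresholdList L) (hnd : (z :: L).Nodup) (ha : a ∈ z :: L) (hb : b ∈ z :: L)
    (hout : ∀ w ∉ z :: L, R w z ∨ ∀ y ∈ L, ¬ G.Adj w y) :
    G.searchColor R z L ≠ G.searchColor R' z L := by
  classical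
  have hab := h.ne
  induction L generalizing z with
  | nil =>
    simp only [List.mem_singleton] at ha hb
    exact (hab (ha.trans hb.symm)).elim
  | cons x L ih =>
    have hzx : G.Adj z x := hz x (by simp)
    have hzL : ∀ y ∈ L, G.Adj z y := fun y hy => hz y (by simp [hy])
    have hndx : (x :: L).Nodup := hnd.of_cons
    have hzL' : z ∉ L := by grind
    have hxL : x ∉ L := by grind
    have hndL : L.Nodup := hndx.of_cons
    have hndz : (z :: L).Nodup := by grind
    have hzx_ne : z ≠ x := hzx.ne
    have hcol_z : ¬ (a ∈ z :: L ∧ b ∈ z :: L) → G.searchColor R z L = G.searchColor R' z L :=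
      h.searchColor_eq hzL hL.2
    by_cases hzxab : s(z, x) = s(a, b)
    · have hzx' := Sym2.eq_iff.1 hzxab
      by_cases hx : ∀ y ∈ L, G.Adj x y
      · have hcount : L.countP (fun y => R y a) = L.countP (fun y => R' y b) := by
          refine List.countP_congr fun y hy => ?_
          have hya : y ≠ a := by grind
          have hyb : y ≠ b := by grind
          have : R y a ↔ R' y b := (h.iff_of_ne hya hyb a).trans
            ⟨h.rel'_of_rel' hya, fun hr => h.right.trans hr h.rel'⟩
          simpa using this
        have hpar : ∀ n, parityColor (n + 1) ≠ parityColor n := fun n => by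
          rw [ne_eq, parityColor_eq_iff, Nat.even_add_one]; grind
        rcases hzx' with ⟨rfl, rfl⟩ | ⟨rfl, rfl⟩
        · rw [searchColor_of_twin_below hx h.rel, searchColor_of_twin_above hx
            (fun hr => hab (h.right.antisymm hr h.rel')), hcount,
            h.searchColor_eq_of_twins hzL hx hzL' hxL hL.2]
          simpa using hpar _
        · rw [searchColor_of_twin_below hx h.rel', searchColor_of_twin_above hx
            (fun hr => hab (h.left.antisymm h.rel hr)), hcount,
            h.searchColor_eq_of_twins hx hzL hxL hzL' hL.2]
          simpa using (hpar _).symm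
      · have hcol := hcol_z (by grind)
        rcases hzx' with ⟨rfl, rfl⟩ | ⟨rfl, rfl⟩
        · rw [searchColor_of_pendant_below hx h.rel, searchColor_of_pendant_above hx
            (fun hr => hab (h.right.antisymm hr h.rel')), hcol]
          simpa using (parityColor_ne_two _).symm
        · rw [searchColor_of_pendant_below hx h.rel', searchColor_of_pendant_above hx
            (fun hr => hab (h.left.antisymm h.rel hr)), hcol]
          simpa using parityColor_ne_two _
    have hR : R z x ↔ R' z x := h.iff_of_adj hzx hzxab
    have hxz : ¬ R z x → R x z := (h.left.total_of_adj hzx).resolve_left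
    have hzx_not : ¬ (z = a ∧ x = b) ∧ ¬ (z = b ∧ x = a) := by
      rw [Sym2.eq_iff] at hzxab
      grind
    -- If `x` is one of the swapped vertices, then the other one is in `L`.
    have hpartner : ∀ {w w' : V}, (w = z ∧ w' = x ∨ w = x ∧ w' = z) → (w = a ∨ w = b) →
        ∃ y ∈ L, s(w, y) = s(a, b) := by
      rintro w w' hw (rfl | rfl)
      · exact ⟨b, by grind, rfl⟩
      · exact ⟨a, by grind, Sym2.eq_swap⟩
    by_cases hx : ∀ y ∈ L, G.Adj x y
    · by_cases hzx' : R z x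
      · rw [searchColor_of_twin_below hx hzx', searchColor_of_twin_below hx (hR.1 hzx')]
        by_cases hzab : z = a ∨ z = b
        · obtain ⟨y, hy, hyab⟩ := hpartner (.inl ⟨rfl, rfl⟩) hzab
          rw [h.searchColor_eq hx hL.2 (by grind)]
          simpa using h.parityColor_ne hndL hzL' hy hyab 1
        · rw [h.countP_eq_of_adj hzL (by simp only [ne_eq, Sym2.eq_iff]; grind)]
          have := ih hx hL.2 hndx (by grind) (by grind) fun w hw => by
            by_cases hwz : w = z
            · exact .inl (hwz ▸ hzx')
            · exact (hout w (by grind)).imp (h.left.trans · hzx') (by grind)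
          simpa using this
      · rw [searchColor_of_twin_above hx hzx', searchColor_of_twin_above hx (mt hR.2 hzx')]
        by_cases hxab : x = a ∨ x = b
        · obtain ⟨y, hy, hyab⟩ := hpartner (.inr ⟨rfl, rfl⟩) hxab
          rw [hcol_z (by grind)]
          simpa using h.parityColor_ne hndL hxL hy hyab 0
        · rw [h.countP_eq_of_adj hx (by simp only [ne_eq, Sym2.eq_iff]; grind)]
          have := ih hzL hL.2 hndz (by grind) (by grind) fun w hw => by
            by_cases hwx : w = x
            · exact .inl (hwx ▸ hxz hzx')
            · exact (hout w (by grind)).imp_right (by grind)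
          simpa using this
    · have hxL' : ∀ y ∈ L, ¬ G.Adj x y := hL.1.resolve_left hx
      have hxab_of : ¬ (x = a ∨ x = b) → G.searchColor R z L ≠ G.searchColor R' z L := fun hxab =>
        ih hzL hL.2 hndz (by grind) (by grind) fun w hw => by
          by_cases hwx : w = x
          · exact .inr (hwx ▸ hxL')
          · exact (hout w (by grind)).imp_right (by grind)
      by_cases hzx' : R z x
      · rw [searchColor_of_pendant_below hx hzx', searchColor_of_pendant_below hx (hR.1 hzx')]
        refine fun he => hxab_of (fun hxab => ?_) (by simpa using he)
        obtain ⟨y, hy, hyab⟩ := hpartner (.inr ⟨rfl, rfl⟩) hxab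
        refine h.ne_of_forall_adj_rel (fun w hxw => ?_) (hxL' y hy) hyab
        by_cases hwz : w = z
        · exact hwz ▸ hzx'
        · have hw : w ∉ z :: x :: L := by
            have := hxw.ne
            grind
          exact h.left.trans ((hout w hw).resolve_right fun hw => hw x (by simp) hxw.symm) hzx'
      · rw [searchColor_of_pendant_above hx hzx', searchColor_of_pendant_above hx (mt hR.2 hzx')]
        by_cases hxab : x = a ∨ x = b
        · obtain ⟨y, hy, hyab⟩ := hpartner (.inr ⟨rfl, rfl⟩) hxab
          rw [hcol_z (by grind)]
          simpa using h.parityColor_ne hndL hxL hy hyab 0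
        · rw [h.countP_eq_of_rel hzL hzx.symm (hxz hzx') (by rwa [Sym2.eq_swap])
            (by simp only [ne_eq, Sym2.eq_iff]; grind)]
          simpa using hxab_of hxab

end AncestorSwap

/-! ### Threshold graphs -/

lemma Connected.isUniversal_of_forall_le (hG : G.Connected) {w : V → ℝ} {t : ℝ}
    (hw : ∀ a b, a ≠ b → (G.Adj a b ↔ t < w a + w b)) {v : V} (hv : ∀ y, w y ≤ w v) :
    G.IsUniversal v := by
  intro y hvy
  have : Nontrivial V := ⟨v, y, hvy⟩
  obtain ⟨z, hyz⟩ := hG.preconnected.exists_adj_of_nontrivial y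
  have := (hw y z hyz.ne).1 hyz
  exact (hw v y hvy).2 (by linarith [hv z])

lemma IsThreshold.exists_isUniversal [Finite V] (hG : G.Connected) (h : G.IsThreshold) :
    ∃ v, G.IsUniversal v := by
  obtain ⟨w, t, hw⟩ := h
  have := hG.nonempty
  obtain ⟨v, hv⟩ := Finite.exists_max w
  exact ⟨v, hG.isUniversal_of_forall_le hw hv⟩

/-- Among finitely many vertices of a threshold graph, the heaviest one is adjacent to all others or
the lightest one is adjacent to no other. -/
lemma IsThreshold.exists_isThresholdList (h : G.IsThreshold) (S : Finset V) :
    ∃ L : List V, L.Nodup ∧ (∀ x, x ∈ L ↔ x ∈ S) ∧ G.IsThresholdList L := by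
  classical
  obtain ⟨w, t, hw⟩ := h
  induction S using Finset.strongInduction with
  | H S ih =>
    rcases S.eq_empty_or_nonempty with rfl | hS
    · exact ⟨[], by simp, by simp, trivial⟩
    obtain ⟨x, hx, hxS⟩ : ∃ x ∈ S, (∀ y ∈ S.erase x, G.Adj x y) ∨ ∀ y ∈ S.erase x, ¬ G.Adj x y := by
      obtain ⟨p, hp, hp'⟩ := S.exists_max_image w hS
      obtain ⟨q, hq, hq'⟩ := S.exists_min_image w hS
      by_cases hpq : t < w p + w q
      · refine ⟨p, hp, .inl fun y hy => ?_⟩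
        obtain ⟨hyp, hy⟩ := Finset.mem_erase.1 hy
        exact (hw p y hyp.symm).2 (by linarith [hq' y hy])
      · refine ⟨q, hq, .inr fun y hy => ?_⟩
        obtain ⟨hyq, hy⟩ := Finset.mem_erase.1 hy
        rw [hw q y hyq.symm]
        linarith [hp' y hy]
    obtain ⟨L, hL, hmem, hthr⟩ := ih _ (Finset.erase_ssubset hx)
    refine ⟨x :: L, List.nodup_cons.2 ⟨by simp [hmem], hL⟩, fun y => ?_, ?_, hthr⟩
    · rw [List.mem_cons, hmem, Finset.mem_erase]
      by_cases hyx : y = x <;> simp [hyx, hx]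
    · simpa only [hmem] using hxS

theorem IsThreshold.colorable_rotationGraph [Finite V] (hG : G.Connected) (h : G.IsThreshold) :
    G.rotationGraph.Colorable 3 := by
  classical
  have := Fintype.ofFinite V
  obtain ⟨z, hz⟩ := h.exists_isUniversal hG
  obtain ⟨L, hL, hmem, hthr⟩ := h.exists_isThresholdList (Finset.univ.erase z)
  have hmem' : ∀ x, x ∈ z :: L := fun x => by simp [hmem, em]
  have key : ∀ T T' : {T : RootedTreeOn V // G.IsSearchTree T},
      (∃ u v, G.IsRotation T.1 T'.1 u v) →
      G.searchColor T.1.IsAncestor z L ≠ G.searchColor T'.1.IsAncestor z L := by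
    rintro T T' ⟨u, v, hr⟩
    exact (hr.ancestorSwap hG T.2 T'.2).searchColor_ne
      (fun y hy => hz (by simpa [hmem, eq_comm] using hy)) hthr
      (List.nodup_cons.2 ⟨by simp [hmem], hL⟩) (hmem' u) (hmem' v) fun w hw => (hw (hmem' w)).elim
  let c : G.rotationGraph.Coloring (ZMod 3) :=
    Coloring.mk (fun T => G.searchColor T.1.IsAncestor z L) fun {T T'} hadj => by
      rcases ((fromRel_adj _ _ _).1 hadj).2 with hr | hr
      · exact key _ _ hr
      · exact (key _ _ hr).symm
  simpa using c.colorable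

lemma IsThreshold.induce (h : G.IsThreshold) (S : Set V) : (G.induce S).IsThreshold := by
  obtain ⟨w, t, hw⟩ := h
  exact ⟨fun x => w x, t, fun a b hab => hw a b (Subtype.coe_ne_coe.2 hab)⟩

/-- A graph arises from any of its vertex-deleted subgraphs by adding the deleted vertex. -/
lemma nonempty_iso_addVertex (G : SimpleGraph V) (y : V) :
    Nonempty ((G.induce {x | x ≠ y}).addVertex {x | G.Adj y x} ≃g G) := by
  classical
  refine ⟨⟨Equiv.optionSubtypeNe y, ?_⟩⟩
  rintro (_ | a) (_ | b)
  · exact iff_of_false G.irrefl fun h => h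
  · exact Iff.rfl
  · exact G.adj_comm _ _
  · exact Iff.rfl

theorem IsThreshold.isTwinPendantBuilt [Finite V] (hG : G.Connected) (h : G.IsThreshold) :
    G.IsTwinPendantBuilt := by
  classical
  induction hn : Nat.card V generalizing V with
  | zero =>
    have := hG.nonempty
    exact (Nat.card_pos.ne' hn).elim
  | succ n ih =>
    rcases subsingleton_or_nontrivial V with hV | hV
    · have := hG.nonempty
      exact .single G Nat.card_unique
    obtain ⟨w, t, hw⟩ := id h
    have := hG.nonempty
    obtain ⟨v, hv⟩ := Finite.exists_max w
    have hvu := hG.isUniversal_of_forall_le hw hv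
    have step : ∀ y (hy : v ≠ y), (G.induce {x | x ≠ y}).IsUniversal ⟨v, hy⟩ ∧
        (G.induce {x | x ≠ y}).IsTwinPendantBuilt := by
      intro y hy
      have hu : (G.induce {x | x ≠ y}).IsUniversal ⟨v, hy⟩ := fun x hx =>
        hvu (Subtype.coe_ne_coe.2 hx)
      refine ⟨hu, ih (.of_isUniversal hu) (h.induce _) ?_⟩
      have := Nat.card_congr (Equiv.optionSubtypeNe y)
      rw [Finite.card_option, hn] at this
      exact Nat.succ.inj this
    by_cases htwin : ∃ y, v ≠ y ∧ G.IsUniversal y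
    · obtain ⟨y, hvy, hy⟩ := htwin
      obtain ⟨hu, hb⟩ := step y hvy
      obtain ⟨e⟩ := G.nonempty_iso_addVertex y
      have hK : {x : {x | x ≠ y} | G.Adj y x} = insert ⟨v, hvy⟩
          ((G.induce {x | x ≠ y}).neighborSet ⟨v, hvy⟩) := by
        rw [insert_neighborSet_eq_univ.2 hu]
        exact Set.eq_univ_of_forall fun x => hy (Ne.symm x.2)
      rw [hK] at e
      exact .iso _ G e (.trueTwin _ _ hu hb)
    · -- The lightest vertex `y` other than `v` is pendant: another neighbour of `y` would be universal.
      obtain ⟨y, hvy, hy⟩ : ∃ y, y ≠ v ∧ ∀ z, z ≠ v → w y ≤ w z := by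
        have := Fintype.ofFinite V
        obtain ⟨y₀, hy₀⟩ := exists_ne v
        obtain ⟨y, hy, hmin⟩ := (Finset.univ.erase v).exists_min_image w ⟨y₀, by simpa using hy₀⟩
        exact ⟨y, by simpa using hy, fun z hz => hmin z (by simpa using hz)⟩
      obtain ⟨hu, hb⟩ := step y hvy.symm
      obtain ⟨e⟩ := G.nonempty_iso_addVertex y
      have hK : {x : {x | x ≠ y} | G.Adj y x} = {⟨v, hvy.symm⟩} := by
        ext ⟨x, hx⟩
        simp only [Set.mem_ofPred_eq, Set.mem_singleton_iff, Subtype.mk.injEq]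
        refine ⟨fun hyx => ?_, fun hxv => hxv ▸ (hvu hvy.symm).symm⟩
        by_contra hxv
        refine htwin ⟨x, Ne.symm hxv, fun z hxz => ?_⟩
        by_cases hzv : z = v
        · exact hzv ▸ (hvu (Ne.symm hxv)).symm
        · have := (hw y x hyx.ne).1 hyx
          exact (hw x z hxz).2 (by linarith [hy z hzv])
      rw [hK] at e
      exact .iso _ G e (.pendant _ _ hu hb)

end SimpleGraph

/-! ### Broom-shaped search trees -/

section

variable {V : Type u} {n : ℕ}

/-- The tree which is a path along the enumeration `σ` down to the vertex `b`, and in which all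
vertices behind `b` are children of `b`. -/
def broomTree (σ : V ≃ Fin n) (b : V) : RootedTreeOn V where
  root := σ.symm ⟨0, (σ b).pos⟩
  parent x := if min (σ x).1 ((σ b).1 + 1) = 0 then none
    else some (σ.symm ⟨min (σ x).1 ((σ b).1 + 1) - 1, by omega⟩)
  parent_eq_none_iff x := by
    rw [Equiv.eq_symm_apply, Fin.ext_iff]
    split_ifs with h <;> simp <;> omega
  reachable x := by
    induction h : (σ x).1 using Nat.strong_induction_on generalizing x with
    | _ k ih =>
      by_cases hk : k = 0
      · have : x = σ.symm ⟨0, (σ b).pos⟩ := by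
          rw [Equiv.eq_symm_apply, Fin.ext_iff]
          exact h.trans hk
        rw [← this]
      · refine .tail (ih (min (σ x).1 ((σ b).1 + 1) - 1) (by omega)
          (σ.symm ⟨min (σ x).1 ((σ b).1 + 1) - 1, by omega⟩) (by simp)) ?_
        rw [if_neg (by omega)]

lemma broomTree_parent_eq_some_iff {σ : V ≃ Fin n} {b x y : V} :
    (broomTree σ b).parent x = some y ↔ min (σ x).1 ((σ b).1 + 1) = (σ y).1 + 1 := by
  simp only [broomTree]
  split_ifs with h
  · simp [h]
  · rw [Option.some_inj, Equiv.symm_apply_eq, Fin.ext_iff]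
    simp only
    omega

lemma apply_broomTree_root {σ : V ≃ Fin n} {b : V} : (σ (broomTree σ b).root).1 = 0 := by
  simp [broomTree]

lemma broomTree_congr {σ σ' : V ≃ Fin n} {b : V}
    (h : ∀ y, σ y ≤ σ b ∨ σ' y ≤ σ' b → σ' y = σ y) : broomTree σ' b = broomTree σ b := by
  have hb : σ' b = σ b := h b (.inl le_rfl)
  rw [hb] at h
  have h' : ∀ y, ((σ y).1 ≤ (σ b).1 ∨ (σ' y).1 ≤ (σ b).1) → (σ' y).1 = (σ y).1 := fun y hy =>
    congrArg Fin.val (h y hy)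
  ext : 1
  · rw [← σ.injective.eq_iff, Fin.ext_iff, apply_broomTree_root, ← h' _ (.inr ?_),
      apply_broomTree_root]
    rw [apply_broomTree_root]
    exact Nat.zero_le _
  · funext x
    refine Option.ext fun y => ?_
    rw [broomTree_parent_eq_some_iff, broomTree_parent_eq_some_iff, hb]
    have := h' x
    have := h' y
    omega

end

namespace SimpleGraph

variable {V : Type u} {G : SimpleGraph V} {T : RootedTreeOn V} {n : ℕ}

lemma IsSearchTreeOn.of_isUniversal {S : Set V} {r b c : V} (hr : r ∈ S) (hb : b ∈ S \ {r})
    (hbu : G.IsUniversal b) (hc : ∀ v, T.parent v = some r ↔ v = c)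
    (h : G.IsSearchTreeOn T (S \ {r}) c) : G.IsSearchTreeOn T S r := by
  have hu : (G.induce (S \ {r})).IsUniversal ⟨b, hb⟩ := fun x hx => hbu (Subtype.coe_ne_coe.2 hx)
  have hcon := (Connected.of_isUniversal hu).preconnected
  have := hcon.subsingleton_connectedComponent
  let C₀ := (G.induce (S \ {r})).connectedComponentMk ⟨b, hb⟩
  refine .node hr (fun _ => c) (fun v => (hc v).trans ⟨fun h => ⟨C₀, h.symm⟩, fun ⟨_, h⟩ => h.symm⟩)
    fun C => ?_
  have : C.supp = Set.univ := Set.eq_univ_of_forall fun x => Subsingleton.elim (α :=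
    (G.induce (S \ {r})).ConnectedComponent) _ _
  rwa [this, Set.image_univ, Subtype.range_coe]

lemma IsSearchTreeOn.singleton {r : V} (hr : ∀ v, T.parent v ≠ some r) :
    G.IsSearchTreeOn T {r} r := by
  have : IsEmpty (G.induce (({r} : Set V) \ {r})).ConnectedComponent :=
    ⟨fun C => by obtain ⟨x, -⟩ := C.nonempty_supp; exact x.2.2 x.2.1⟩
  exact .node rfl isEmptyElim (fun v => by simp [hr v]) isEmptyElim

lemma IsSearchTreeOn.of_forall_not_adj {S : Set V} {r : V} (hr : r ∈ S)
    (hS : ∀ x ∈ S \ {r}, ∀ y ∈ S \ {r}, ¬ G.Adj x y)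
    (hc : ∀ v, T.parent v = some r ↔ v ∈ S \ {r})
    (hleaf : ∀ x ∈ S \ {r}, ∀ v, T.parent v ≠ some x) : G.IsSearchTreeOn T S r := by
  have hbot : G.induce (S \ {r}) = ⊥ := by
    ext x y
    exact iff_of_false (hS x x.2 y y.2) id
  have hout : ∀ x, (Quot.out ((G.induce (S \ {r})).connectedComponentMk x)) = x := fun x => by
    have := ConnectedComponent.exact (Quot.out_eq ((G.induce (S \ {r})).connectedComponentMk x))
    rwa [hbot, reachable_bot, ← hbot] at this
  refine .node hr (fun C => (Quot.out C).1) (fun v => (hc v).trans ⟨fun hv => ?_, ?_⟩) fun C => ?_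
  · exact ⟨(G.induce (S \ {r})).connectedComponentMk ⟨v, hv⟩, by rw [hout]⟩
  · rintro ⟨C, rfl⟩
    exact (Quot.out C).2
  · induction C using ConnectedComponent.ind with
    | h x =>
      have : Subtype.val '' ((G.induce (S \ {r})).connectedComponentMk x).supp = {x.1} := by
        ext y
        simp only [Set.mem_image, ConnectedComponent.mem_supp_iff, Set.mem_singleton_iff]
        constructor
        · rintro ⟨z, hz, rfl⟩
          rw [← hout x, ← hout z, hz]
        · rintro rfl
          exact ⟨x, rfl, rfl⟩
      rw [hout, this]
      exact .singleton (hleaf x x.2)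

lemma isSearchTree_broomTree {σ : V ≃ Fin n} {b : V} (hb : G.IsUniversal b)
    (hσ : ∀ x y, σ b < σ x → σ b < σ y → ¬ G.Adj x y) : G.IsSearchTree (broomTree σ b) := by
  have key : ∀ d r, (σ r).1 + d = (σ b).1 →
      G.IsSearchTreeOn (broomTree σ b) {x | σ r ≤ σ x} r := by
    have hmem : ∀ r x, x ∈ {x | σ r ≤ σ x} \ {r} ↔ (σ r).1 + 1 ≤ (σ x).1 := fun r x => by
      rw [Set.mem_sdiff, Set.mem_ofPred_eq, Set.mem_singleton_iff, ← σ.injective.eq_iff, Fin.ext_iff,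
        Fin.le_def]
      omega
    intro d
    induction d with
    | zero =>
      intro r hr
      obtain rfl : r = b := σ.injective (Fin.ext hr)
      refine .of_forall_not_adj (Set.mem_ofPred.2 le_rfl) (fun x hx y hy => hσ x y ?_ ?_) (fun v => ?_) fun x hx v => ?_
      · exact (hmem _ _).1 hx
      · exact (hmem _ _).1 hy
      · rw [broomTree_parent_eq_some_iff, hmem]
        omega
      · have := (hmem _ _).1 hx
        rw [ne_eq, broomTree_parent_eq_some_iff]
        omega
    | succ d ih =>
      intro r hr
      let c := σ.symm ⟨(σ r).1 + 1, by omega⟩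
      have hc : (σ c).1 = (σ r).1 + 1 := by simp [c]
      refine .of_isUniversal (Set.mem_ofPred.2 le_rfl) ((hmem r b).2 (by omega)) hb (c := c) (fun v => ?_) ?_
      · rw [broomTree_parent_eq_some_iff, ← σ.injective.eq_iff, Fin.ext_iff]
        omega
      · convert ih c (by omega) using 1
        ext x
        rw [hmem, ← hc]
        rfl
  have := key (σ b).1 (broomTree σ b).root (by simp [apply_broomTree_root])
  have huniv : {x | σ (broomTree σ b).root ≤ σ x} = Set.univ := Set.eq_univ_of_forall fun x => by
    rw [Set.mem_ofPred_eq, Fin.le_def, apply_broomTree_root]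
    exact Nat.zero_le _
  rwa [huniv] at this

/-- Exchanging two consecutive entries `u`, `v` of the enumeration rotates the broom. If `b` is
neither of them it is required to follow immediately, so that it is the only child of `v`. -/
lemma isRotation_broomTree [DecidableEq V] {σ : V ≃ Fin n} {b u v : V} (hb : G.IsUniversal b)
    (huv : (σ v).1 = (σ u).1 + 1) (h : u = b ∨ (σ b).1 = (σ v).1 + 1) :
    G.IsRotation (broomTree σ b) (broomTree ((Equiv.swap u v).trans σ) b) u v := by
  have hne : u ≠ v := by rintro rfl; omega
  have hvb : v ≠ b := by
    rintro rfl
    rcases h with rfl | h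
    · exact hne rfl
    · omega
  set σ' := (Equiv.swap u v).trans σ with hσ'
  have hu : σ' u = σ v := by simp [hσ']
  have hv : σ' v = σ u := by simp [hσ']
  have hw : ∀ w, w ≠ u → w ≠ v → σ' w = σ w := fun w h₁ h₂ => by
    simp [hσ', Equiv.swap_apply_of_ne_of_ne h₁ h₂]
  have hinj : ∀ {x y}, x ≠ y → (σ x).1 ≠ (σ y).1 := fun hxy he => hxy (σ.injective (Fin.ext he))
  have hwb : ∀ w, (broomTree σ b).parent w = some v → w = b ∧ u ≠ b := fun w h' => by
    rw [broomTree_parent_eq_some_iff] at h'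
    rcases h with rfl | h
    · omega
    · exact ⟨σ.injective (Fin.ext (by omega)), by rintro rfl; omega⟩
  have hb' : (σ' b).1 = if u = b then (σ b).1 + 1 else (σ b).1 := by
    split_ifs with hub
    · rw [← hub, hu, huv]
    · rw [hw b (Ne.symm hub) hvb.symm]
  have hbu : u = b ∧ (σ b).1 = (σ u).1 ∨ u ≠ b ∧ (σ b).1 = (σ v).1 + 1 := by
    by_cases hub : u = b
    · exact .inl ⟨hub, hub ▸ rfl⟩
    · exact .inr ⟨hub, h.resolve_left hub⟩
  have hy : ∀ y, y = u ∧ (σ' y).1 = (σ v).1 ∧ (σ y).1 = (σ u).1 ∨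
      y = v ∧ (σ' y).1 = (σ u).1 ∧ (σ y).1 = (σ v).1 ∨
      (σ' y).1 = (σ y).1 ∧ (σ y).1 ≠ (σ u).1 ∧ (σ y).1 ≠ (σ v).1 := fun y => by
    by_cases hyu : y = u
    · exact .inl ⟨hyu, by rw [hyu, hu], by rw [hyu]⟩
    by_cases hyv : y = v
    · exact .inr (.inl ⟨hyv, by rw [hyv, hv], by rw [hyv]⟩)
    · exact .inr (.inr ⟨by rw [hw y hyu hyv], hinj hyu, hinj hyv⟩)
  constructor
  · rw [broomTree_parent_eq_some_iff]
    omega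
  · rw [broomTree_parent_eq_some_iff, hu, hv, hb']
    split_ifs <;> omega
  · refine Option.ext fun y => ?_
    rw [broomTree_parent_eq_some_iff, broomTree_parent_eq_some_iff, hv, hb']
    have := hy y
    split_ifs <;> omega
  · intro w hwv _
    obtain ⟨rfl, hub⟩ := hwb w hwv
    have := (hbu.resolve_left fun h => hub h.1).2
    rw [broomTree_parent_eq_some_iff, hu, hb', if_neg hub]
    omega
  · intro w hwv hnot
    obtain ⟨rfl, hub⟩ := hwb w hwv
    exact (hnot ⟨w, RootedTreeOn.isAncestor_refl w, (hb (Ne.symm hub)).symm⟩).elim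
  · intro w hwu hwv hpar
    refine Option.ext fun y => ?_
    rw [ne_eq, broomTree_parent_eq_some_iff] at hpar
    rw [broomTree_parent_eq_some_iff, broomTree_parent_eq_some_iff, hw w hwu hwv, hb']
    have := hy y
    have := hinj hwu
    have := hinj hwv
    rcases hbu with ⟨hub, hσb⟩ | ⟨hub, hσb⟩
    · rw [if_pos hub]
      omega
    · rw [if_neg hub]
      omega

/-! ### A cycle of length five -/

lemma exists_equiv_fin_of_three [Finite V] {a b d : V} (hba : b ≠ a) (hbd : b ≠ d) (had : a ≠ d) :
    ∃ (m : ℕ) (σ : V ≃ Fin (m + 3)), (σ b).1 = m ∧ (σ a).1 = m + 1 ∧ (σ d).1 = m + 2 := by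
  classical
  have := Fintype.ofFinite V
  have hcard : 3 ≤ Fintype.card V := by
    rw [← Finset.card_eq_three.2 ⟨b, a, d, hba, hbd, had, rfl⟩]
    exact Finset.card_le_univ _
  obtain ⟨m, hm⟩ := Nat.exists_eq_add_of_le' hcard
  let σ₀ : V ≃ Fin (m + 3) := Fintype.equivFinOfCardEq hm
  let σ₁ := σ₀.trans (Equiv.swap (σ₀ d) ⟨m + 2, by omega⟩)
  let σ₂ := σ₁.trans (Equiv.swap (σ₁ a) ⟨m + 1, by omega⟩)
  let σ₃ := σ₂.trans (Equiv.swap (σ₂ b) ⟨m, by omega⟩)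
  have h₁ : σ₁ d = ⟨m + 2, by omega⟩ := by simp [σ₁]
  have h₂ : σ₂ a = ⟨m + 1, by omega⟩ := by simp [σ₂]
  have h₂' : σ₂ d = ⟨m + 2, by omega⟩ := by
    rw [← h₁]
    refine Equiv.swap_apply_of_ne_of_ne (σ₁.injective.ne had.symm) ?_
    simp [h₁]
  have hfix : ∀ x, b ≠ x → σ₂ x ≠ ⟨m, by omega⟩ → σ₃ x = σ₂ x := fun x hx hxm =>
    Equiv.swap_apply_of_ne_of_ne (σ₂.injective.ne hx.symm) hxm
  refine ⟨m, σ₃, by simp [σ₃], ?_, ?_⟩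
  · rw [hfix a hba (by simp [h₂]), h₂]
  · rw [hfix d hbd (by simp [h₂']), h₂']

/-- The order of the vertices behind `b` does not matter. -/
lemma broomTree_swap_behind [DecidableEq V] {σ : V ≃ Fin n} {a b d : V} (ha : σ b < σ a)
    (hd : σ b < σ d) : broomTree ((Equiv.swap a d).trans σ) b = broomTree σ b := by
  have hba : b ≠ a := by rintro rfl; exact ha.false
  have hbd : b ≠ d := by rintro rfl; exact hd.false
  refine broomTree_congr fun y hy => ?_
  rw [Equiv.trans_apply, Equiv.trans_apply, Equiv.swap_apply_of_ne_of_ne hba hbd] at hy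
  by_cases hya : y = a
  · subst hya
    rw [Equiv.swap_apply_left] at hy
    exact (hy.elim ha.not_ge hd.not_ge).elim
  by_cases hyd : y = d
  · subst hyd
    rw [Equiv.swap_apply_right] at hy
    exact (hy.elim hd.not_ge ha.not_ge).elim
  rw [Equiv.trans_apply, Equiv.swap_apply_of_ne_of_ne hya hyd]

/-- Rearranging the last three entries of an enumeration in which only these can be behind `b` leads
to a broom which is a search tree. -/
lemma isSearchTree_broomTree_of_agree {m : ℕ} {σ σ' : V ≃ Fin (m + 3)} {a b d : V}
    (hb : G.IsUniversal b) (hadj : ¬ G.Adj a d) (hσb : (σ b).1 = m) (hσa : (σ a).1 = m + 1)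
    (hσd : (σ d).1 = m + 2) (h₁ : ∀ x, x ≠ a → x ≠ b → x ≠ d → σ' x = σ x) (h₂ : m ≤ (σ' b).1) :
    G.IsSearchTree (broomTree σ' b) := by
  have hoff : ∀ x, x ≠ a → x ≠ b → x ≠ d → (σ x).1 < m := fun x hxa hxb hxd => by
    have hne : ∀ {y}, x ≠ y → (σ x).1 ≠ (σ y).1 := fun hxy he => hxy (σ.injective (Fin.ext he))
    have := hne hxa
    have := hne hxb
    have := hne hxd
    omega
  have hmem : ∀ x, σ' b < σ' x → x = a ∨ x = d := fun x hx => by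
    by_contra! hxad
    by_cases hxb : x = b
    · exact hx.ne (hxb ▸ rfl)
    · have := hoff x hxad.1 hxb hxad.2
      rw [h₁ x hxad.1 hxb hxad.2, Fin.lt_def] at hx
      omega
  refine isSearchTree_broomTree hb fun x y hx hy hxy => ?_
  rcases hmem x hx with rfl | rfl <;> rcases hmem y hy with rfl | rfl
  · exact hxy.ne rfl
  · exact hadj hxy
  · exact hadj hxy.symm
  · exact hxy.ne rfl

lemma not_colorable_two_of_cycle {W : Type*} {H : SimpleGraph W} {x₁ x₂ x₃ x₄ x₅ : W}
    (h₁₂ : H.Adj x₁ x₂) (h₂₃ : H.Adj x₂ x₃) (h₃₄ : H.Adj x₃ x₄) (h₄₅ : H.Adj x₄ x₅)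
    (h₅₁ : H.Adj x₅ x₁) : ¬ H.Colorable 2 := by
  rintro ⟨c⟩
  have := c.valid h₁₂
  have := c.valid h₂₃
  have := c.valid h₃₄
  have := c.valid h₄₅
  have := c.valid h₅₁
  omega

lemma rotationGraph_adj_of_isRotation {T T' : RootedTreeOn V} (hT : G.IsSearchTree T)
    (hT' : G.IsSearchTree T') {u v : V} (h : G.IsRotation T T' u v) :
    G.rotationGraph.Adj ⟨T, hT⟩ ⟨T', hT'⟩ :=
  (fromRel_adj _ _ _).2 ⟨fun he => h.ne (congrArg Subtype.val he), .inl ⟨u, v, h⟩⟩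

/-- The search trees on a path `a`, `b`, `d` form a cycle of length five; here they are placed below
a common path through all other vertices. -/
theorem not_colorable_two_rotationGraph [Finite V] {a b d : V} (hb : G.IsUniversal b)
    (hba : b ≠ a) (hbd : b ≠ d) (had : a ≠ d) (hadj : ¬ G.Adj a d) :
    ¬ G.rotationGraph.Colorable 2 := by
  classical
  obtain ⟨m, σ, hσb, hσa, hσd⟩ := exists_equiv_fin_of_three hba hbd had
  -- The names of the enumerations spell out their last three vertices.
  obtain ⟨σabd, e_abd⟩ : ∃ τ, τ = (Equiv.swap b a).trans σ := ⟨_, rfl⟩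
  obtain ⟨σadb, e_adb⟩ : ∃ τ, τ = (Equiv.swap b d).trans σabd := ⟨_, rfl⟩
  obtain ⟨σdab, e_dab⟩ : ∃ τ, τ = (Equiv.swap a d).trans σadb := ⟨_, rfl⟩
  obtain ⟨σbda, e_bda⟩ : ∃ τ, τ = (Equiv.swap a d).trans σ := ⟨_, rfl⟩
  obtain ⟨σdba, e_dba⟩ : ∃ τ, τ = (Equiv.swap b d).trans σbda := ⟨_, rfl⟩
  have hab := hba.symm
  have hdb := hbd.symm
  have hda := had.symm
  have abd_b : σabd b = σ a := by simp [e_abd]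
  have abd_a : σabd a = σ b := by simp [e_abd]
  have abd_d : σabd d = σ d := by simp [e_abd, Equiv.swap_apply_of_ne_of_ne hdb hda]
  have adb_b : σadb b = σ d := by simp [e_adb, abd_d]
  have adb_d : σadb d = σ a := by simp [e_adb, abd_b]
  have adb_a : σadb a = σ b := by simp [e_adb, Equiv.swap_apply_of_ne_of_ne hab had, abd_a]
  have bda_b : σbda b = σ b := by simp [e_bda, Equiv.swap_apply_of_ne_of_ne hba hbd]
  have bda_a : σbda a = σ d := by simp [e_bda]
  have bda_d : σbda d = σ a := by simp [e_bda]
  have dba_b : σdba b = σ a := by simp [e_dba, bda_d]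
  have dba_d : σdba d = σ b := by simp [e_dba, bda_b]
  have dba_a : σdba a = σ d := by simp [e_dba, Equiv.swap_apply_of_ne_of_ne hab had, bda_a]
  have hdab : (Equiv.swap b a).trans σdba = σdab := by
    ext x
    simp only [e_dab, e_dba, e_adb, e_abd, e_bda, Equiv.trans_apply, Equiv.swap_apply_def]
    grind
  have hbda : broomTree σbda b = broomTree σ b :=
    e_bda ▸ broomTree_swap_behind (Fin.lt_def.2 (by omega)) (Fin.lt_def.2 (by omega))
  have dab_b : σdab b = σ d := by simp [e_dab, Equiv.swap_apply_of_ne_of_ne hba hbd, adb_b]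
  have hsearch : ∀ {σ' : V ≃ Fin (m + 3)}, (∀ x, x ≠ a → x ≠ b → x ≠ d → σ' x = σ x) →
      m ≤ (σ' b).1 → G.IsSearchTree (broomTree σ' b) :=
    isSearchTree_broomTree_of_agree hb hadj hσb hσa hσd
  have h_abd : ∀ x, x ≠ a → x ≠ b → x ≠ d → σabd x = σ x := fun x h₁ h₂ h₃ => by
    simp [e_abd, Equiv.swap_apply_of_ne_of_ne h₂ h₁]
  have h_adb : ∀ x, x ≠ a → x ≠ b → x ≠ d → σadb x = σ x := fun x h₁ h₂ h₃ => by
    simp [e_adb, Equiv.swap_apply_of_ne_of_ne h₂ h₃, h_abd x h₁ h₂ h₃]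
  have h_dab : ∀ x, x ≠ a → x ≠ b → x ≠ d → σdab x = σ x := fun x h₁ h₂ h₃ => by
    simp [e_dab, Equiv.swap_apply_of_ne_of_ne h₁ h₃, h_adb x h₁ h₂ h₃]
  have h_bda : ∀ x, x ≠ a → x ≠ b → x ≠ d → σbda x = σ x := fun x h₁ h₂ h₃ => by
    simp [e_bda, Equiv.swap_apply_of_ne_of_ne h₁ h₃]
  have h_dba : ∀ x, x ≠ a → x ≠ b → x ≠ d → σdba x = σ x := fun x h₁ h₂ h₃ => by
    simp [e_dba, Equiv.swap_apply_of_ne_of_ne h₂ h₃, h_bda x h₁ h₂ h₃]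
  have t_bad : G.IsSearchTree (broomTree σ b) := hsearch (fun _ _ _ _ => rfl) hσb.ge
  have t_abd : G.IsSearchTree (broomTree σabd b) := hsearch h_abd (by rw [abd_b]; omega)
  have t_adb : G.IsSearchTree (broomTree σadb b) := hsearch h_adb (by rw [adb_b]; omega)
  have t_dab : G.IsSearchTree (broomTree σdab b) := hsearch h_dab (by rw [dab_b]; omega)
  have t_dba : G.IsSearchTree (broomTree σdba b) := hsearch h_dba (by rw [dba_b]; omega)
  have r₁ : G.IsRotation (broomTree σ b) (broomTree σabd b) b a :=
    e_abd ▸ isRotation_broomTree hb (by omega) (.inl rfl)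
  have r₂ : G.IsRotation (broomTree σabd b) (broomTree σadb b) b d :=
    e_adb ▸ isRotation_broomTree hb (by rw [abd_d, abd_b]; omega) (.inl rfl)
  have r₃ : G.IsRotation (broomTree σadb b) (broomTree σdab b) a d :=
    e_dab ▸ isRotation_broomTree hb (by rw [adb_d, adb_a]; omega)
      (.inr (by rw [adb_d, adb_b]; omega))
  have r₄ : G.IsRotation (broomTree σdba b) (broomTree σdab b) b a :=
    hdab ▸ isRotation_broomTree hb (by rw [dba_a, dba_b]; omega) (.inl rfl)
  have r₅ : G.IsRotation (broomTree σ b) (broomTree σdba b) b d :=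
    hbda ▸ e_dba ▸ isRotation_broomTree hb (by rw [bda_d, bda_b]; omega) (.inl rfl)
  exact not_colorable_two_of_cycle (rotationGraph_adj_of_isRotation t_bad t_abd r₁)
    (rotationGraph_adj_of_isRotation t_abd t_adb r₂)
    (rotationGraph_adj_of_isRotation t_adb t_dab r₃)
    (rotationGraph_adj_of_isRotation t_dba t_dab r₄).symm
    (rotationGraph_adj_of_isRotation t_bad t_dba r₅).symm

theorem IsThreshold.chromaticNumber_rotationGraph [Finite V] (hG : G.Connected)
    (h : G.IsThreshold) (htop : G ≠ ⊤) : G.rotationGraph.chromaticNumber = 3 := by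
  obtain ⟨b, hb⟩ := h.exists_isUniversal hG
  obtain ⟨a, ha⟩ : ∃ a, ¬ G.IsUniversal a := by
    simpa [eq_top_iff_forall_isUniversal] using htop
  obtain ⟨d, had, hadj⟩ : ∃ d, a ≠ d ∧ ¬ G.Adj a d := by
    simpa [IsUniversal] using ha
  have hba : b ≠ a := by rintro rfl; exact ha hb
  have hbd : b ≠ d := by rintro rfl; exact hadj (hb hba).symm
  exact chromaticNumber_eq_iff_colorable_not_colorable.2
    ⟨h.colorable_rotationGraph hG, not_colorable_two_rotationGraph hb hba hbd had hadj⟩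

/-! ### Complete split graphs and stars -/

lemma completeSplitGraph_adj {p q : ℕ} {x y : Fin p ⊕ Fin q} :
    (completeSplitGraph p q).Adj x y ↔ x ≠ y ∧ (x.isLeft ∨ y.isLeft) := by
  simp only [completeSplitGraph, fromRel_adj]
  tauto

lemma isThreshold_completeSplitGraph (p q : ℕ) : (completeSplitGraph p q).IsThreshold := by
  refine ⟨fun x => if x.isLeft then 1 else 0, 1 / 2, fun x y hxy => ?_⟩
  rw [completeSplitGraph_adj]
  rcases x with x | x <;> rcases y with y | y <;> simp [hxy] <;> norm_num

lemma isThreshold_starGraph (c : V) : (starGraph c).IsThreshold := by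
  classical
  refine ⟨fun x => if x = c then 1 else 0, 1 / 2, fun x y hxy => ?_⟩
  rw [starGraph_adj]
  by_cases hx : x = c <;> by_cases hy : y = c <;> simp [hx, hy] <;> norm_num
  · exact hxy (hx.trans hy.symm)
  · exact Ne.symm hy

lemma starGraph_ne_top [Finite V] (c : V) (h : 3 ≤ Nat.card V) : starGraph c ≠ ⊤ := by
  classical
  have := Fintype.ofFinite V
  rw [Nat.card_eq_fintype_card, ← Finset.card_univ] at h
  obtain ⟨x, hx, y, hy, hxy⟩ := Finset.one_lt_card.1 (show 1 < (Finset.univ.erase c).card by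
    rw [Finset.card_erase_of_mem (Finset.mem_univ c)]
    omega)
  intro htop
  have : (starGraph c).Adj x y := by rw [htop]; exact hxy
  rcases (starGraph_adj.1 this).2 with rfl | rfl
  · simp at hx
  · simp at hy

end SimpleGraph

theorem mainTheorem2 :
    (∀ (V : Type u) [Finite V] (G : SimpleGraph V), G.Connected → G.IsThreshold → G ≠ ⊤ →
      G.rotationGraph.chromaticNumber = 3) ∧
    (∀ p q : ℕ, 1 ≤ p → 2 ≤ q →
      (SimpleGraph.completeSplitGraph p q).Connected ∧
      (SimpleGraph.completeSplitGraph p q).IsThreshold ∧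
      SimpleGraph.completeSplitGraph p q ≠ ⊤ ∧
      (SimpleGraph.completeSplitGraph p q).rotationGraph.chromaticNumber = 3) ∧
    (∀ (V : Type u) [Finite V] (c : V), 3 ≤ Nat.card V →
      (SimpleGraph.starGraph c).Connected ∧
      (SimpleGraph.starGraph c).IsThreshold ∧
      SimpleGraph.starGraph c ≠ ⊤ ∧
      (SimpleGraph.starGraph c).rotationGraph.chromaticNumber = 3) ∧
    (∀ (V : Type u) [Finite V] (G : SimpleGraph V), G.Connected → G.IsThreshold →
      G.IsTwinPendantBuilt) := by
  refine ⟨fun V _ G hG h htop => h.chromaticNumber_rotationGraph hG htop, fun p q hp hq => ?_,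
    fun V _ c hc => ?_, fun V _ G hG h => h.isTwinPendantBuilt hG⟩
  · have hcon : (SimpleGraph.completeSplitGraph p q).Connected :=
      .of_isUniversal (v := .inl ⟨0, hp⟩) fun y hy => SimpleGraph.completeSplitGraph_adj.2 ⟨hy, by simp⟩
    have hthr := SimpleGraph.isThreshold_completeSplitGraph p q
    have htop : SimpleGraph.completeSplitGraph p q ≠ ⊤ := by
      intro htop
      have h01 : (Sum.inr ⟨0, by omega⟩ : Fin p ⊕ Fin q) ≠ Sum.inr ⟨1, hq⟩ := by simp
      have : (SimpleGraph.completeSplitGraph p q).Adj (Sum.inr ⟨0, by omega⟩) (Sum.inr ⟨1, hq⟩) := by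
        rw [htop]
        exact h01
      simpa using (SimpleGraph.completeSplitGraph_adj.1 this).2
    exact ⟨hcon, hthr, htop, hthr.chromaticNumber_rotationGraph hcon htop⟩
  · have hcon := SimpleGraph.connected_starGraph c
    have hthr := SimpleGraph.isThreshold_starGraph c
    have htop := SimpleGraph.starGraph_ne_top c hc
    exact ⟨hcon, hthr, htop, hthr.chromaticNumber_rotationGraph hcon htop⟩
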